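/- Let $\mathbb S^1=\mathbb R/\mathbb Z$ carry Lebesgue measure of total mass $1$ and the geodesic distance $d(x,y)=\min\{|x-y|,\,1-|x-y|\}$ for representatives $x,y\in[0,1)$. Let $f,g$ be probability densities on $\mathbb S^1$ (nonnegative almost everywhere, integrable, of integral $1$), also regarded as $1$-periodic functions on $\mathbb R$. For $t\in\mathbb R$ put $$F(t)=\int_0^t f(\tau)\,d\tau,\qquad G(t)=\int_0^t g(\tau)\,d\tau ,$$ so that $F(t+1)=F(t)+1$ and $G(t+1)=G(t)+1$, and for $H=F$ or $H=G+\alpha$ with $\alpha\in\mathbb R$ put $H^{-1}(y)=\inf\{t\in\mathbb R: y<H(t)\}$. Let $W_2(f,g)$ be the quadratic Wasserstein distance, $$W_2^2(f,g)=\inf_T\int_{\mathbb S^1} d(x,T(x))^2 f(x)\,dx ,$$ the infimum being over all measurable maps $T:\mathbb S^1\to\mathbb S^1$ that push $f\,dx$ forward to $g\,dx$; a map attaining this infimum is called optimal. Then $$W_2^2(f,g)=\inf_{\alpha\in\mathbb R}\int_0^1\bigl|F^{-1}(t)-(G+\alpha)^{-1}(t)\bigr|^2\,dt .$$ Moreover,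 the infimum on the right is attained at exactly one $\alpha^*\in\mathbb R$, and the map $T=(G+\alpha^*)^{-1}\circ F$ (evaluated at the representative of a point in $[0,1)$ and reduced modulo $1$) is the optimal map: it pushes $f\,dx$ forward to $g\,dx$, it attains the infimum defining $W_2^2(f,g)$, and every optimal map coincides with $T$ at $f\,dx$-almost every point. -/

import Mathlib

open MeasureTheory Set
open scoped ENNReal

noncomputable section

namespace CircleOT

/-! ### Monge transport and the quadratic Wasserstein distance -/

section Monge

variable {M : Type*} [PseudoEMetricSpace M] [MeasurableSpace M]

/-- The quadratic transport cost `∫ d(x, T x)² dμ(x)` of a map `T`. -/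
def transportCost (μ : Measure M) (T : M → M) : ℝ≥0∞ :=
  ∫⁻ x, edist x (T x) ^ 2 ∂μ

/-- The quadratic Wasserstein distance: the square root of the infimum of the transport cost over
all rearrangement maps, i.e. measurable `T` with `ν B = μ (T ⁻¹' B)` for all measurable `B`. -/
def wasserstein2 (μ ν : Measure M) : ℝ≥0∞ :=
  (⨅ (T : M → M) (_ : MeasurePreserving T μ ν), transportCost μ T) ^ (1 / 2 : ℝ)

/-- `T` is an optimal map from `μ` to `ν`: it rearranges `μ` into `ν` and its transport cost is
minimal among all such maps. -/
def IsOptimalMap (μ ν : Measure M) (T : M → M) : Prop :=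
  MeasurePreserving T μ ν ∧
    ∀ S : M → M, MeasurePreserving S μ ν → transportCost μ T ≤ transportCost μ S

end Monge

/-! ### Densities on the circle

`UnitAddCircle` is `ℝ / ℤ`; its volume is Lebesgue measure of total mass one, and its distance is
the geodesic one, `min |x - y| (1 - |x - y|)` for representatives `x, y ∈ [0, 1)`. -/

/-- `f` is a probability density on the circle. -/
structure IsProbDensity (f : UnitAddCircle → ℝ) : Prop where
  nonneg : ∀ᵐ x, 0 ≤ f x
  integrable : Integrable f
  integral_eq_one : ∫ x, f x = 1

/-- The measure `f(x) dx` on the circle. -/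
def densityMeasure (f : UnitAddCircle → ℝ) : Measure UnitAddCircle :=
  volume.withDensity fun x => ENNReal.ofReal (f x)

/-- The distribution function `F(t) = ∫₀ᵗ f(τ) dτ`, `t ∈ ℝ`, of the 1-periodic extension of `f`
(the integral is oriented, so `F` is negative of a mass for `t < 0`). -/
def cdf (f : UnitAddCircle → ℝ) (t : ℝ) : ℝ :=
  ∫ τ in (0 : ℝ)..t, f (τ : UnitAddCircle)

/-- The generalized inverse `H⁻¹(y) = inf {t : y < H(t)}` of a distribution function on `ℝ`. -/
def genInv (H : ℝ → ℝ) (y : ℝ) : ℝ :=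
  sInf {t : ℝ | y < H t}

/-- `∫₀¹ |F⁻¹(t) - (G + α)⁻¹(t)|² dt`. -/
def shiftCost (f g : UnitAddCircle → ℝ) (α : ℝ) : ℝ≥0∞ :=
  ∫⁻ t in Ioo (0 : ℝ) 1,
    ENNReal.ofReal (|genInv (cdf f) t - genInv (fun s => cdf g s + α) t| ^ 2)

/-- The map `(G + α)⁻¹ ∘ F` on the circle, computed on the representative in `[0, 1)` of a point
and reduced modulo one. -/
def shiftMap (f g : UnitAddCircle → ℝ) (α : ℝ) (x : UnitAddCircle) : UnitAddCircle :=
  ((genInv (fun s => cdf g s + α) (cdf f (AddCircle.equivIco 1 0 x : ℝ)) : ℝ) : UnitAddCircle)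

end CircleOT

end

/-! Let `u`, `v` be the quantile functions of `f`, `g`. With `t` uniform on `(0, 1)`, the pair `(u
t, v (t - β))`, reduced modulo one, couples `f dx` and `g dx` for every `β`, and so does `(u t, S (u
t))` for every transport map `S`. Hence any bounded measurable potentials with `Φ x + Ψ y ≤ dist x y
^ 2` bound all shift costs and all transport costs below by the same number `K = ∫ Φ f + ∫ Ψ g`. It
remains to find potentials for which one shift attains `K`.

On the line, `Φ x = x ^ 2 - 2 ∫₀ˣ T` is a potential for a monotone map `T`. It descends to the
circle exactly when `T x - x` has mean zero, and this condition selects the shift: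
`exists_balanced_selection` finds `α` and a balanced monotone `T` with `G (T x) = F x - α`. With `Ψ`
the transform of `Φ` for the squared distance, `exists_dual_potentials` shows that equality holds
along the graph of `T`, and only there over continuity points of `T`. Since `T (u t) = v (t - α)`
for almost every `t`, the shift `α` attains `K`. The equality case of duality forces any other
minimiser to follow `T`, which gives both uniqueness claims. -/

namespace CircleOT

open Filter Topology

/-! ### Lifts of degree-one circle maps and their generalized inverses -/

/-- A continuous monotone `H : ℝ → ℝ` with `H (t + 1) = H t + 1`. -/
structure IsMonotoneLift (H : ℝ → ℝ) : Prop where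
  continuous : Continuous H
  monotone : Monotone H
  add_one : ∀ t, H (t + 1) = H t + 1

namespace IsMonotoneLift

variable {H : ℝ → ℝ}

lemma natCast (h : IsMonotoneLift H) (n : ℕ) : H n = H 0 + n := by
  induction n with
  | zero => simp
  | succ n ih => push_cast; rw [h.add_one, ih]; ring

lemma neg_natCast (h : IsMonotoneLift H) (n : ℕ) : H (-n) = H 0 - n := by
  induction n with
  | zero => simp
  | succ n ih =>
    have := h.add_one (-(n + 1 : ℝ))
    push_cast
    rw [show -(n + 1 : ℝ) + 1 = -n by ring, ih] at this
    linarith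

lemma superlevel_nonempty (h : IsMonotoneLift H) (y : ℝ) : {t | y < H t}.Nonempty := by
  obtain ⟨n, hn⟩ := exists_nat_gt (y - H 0)
  exact ⟨n, by simp only [mem_ofPred_eq, h.natCast]; linarith⟩

lemma bddBelow_superlevel (h : IsMonotoneLift H) (y : ℝ) : BddBelow {t | y < H t} := by
  obtain ⟨n, hn⟩ := exists_nat_gt (H 0 - y)
  refine ⟨-n, fun t ht => ?_⟩
  by_contra! hlt
  have := h.monotone hlt.le
  rw [h.neg_natCast] at this
  simp only [mem_ofPred_eq] at ht
  linarith

lemma genInv_lt_iff (h : IsMonotoneLift H) {y t : ℝ} :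
    genInv H y < t ↔ ∃ s, y < H s ∧ s < t :=
  csInf_lt_iff (h.bddBelow_superlevel y) (h.superlevel_nonempty y)

/-- To the left of the infimum `H ≤ y`, while the infimum is a limit of points with `y < H`;
continuity of `H` closes the gap. -/
lemma apply_genInv (h : IsMonotoneLift H) (y : ℝ) : H (genInv H y) = y := by
  apply le_antisymm
  · have ht : Tendsto H (𝓝[<] genInv H y) (𝓝 (H (genInv H y))) :=
      h.continuous.continuousAt.tendsto.mono_left nhdsWithin_le_nhds
    refine le_of_tendsto ht ?_
    filter_upwards [self_mem_nhdsWithin] with t ht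
    by_contra! hlt
    exact absurd (csInf_le (h.bddBelow_superlevel y) hlt) (not_le.mpr ht)
  · have hmem := csInf_mem_closure (h.superlevel_nonempty y) (h.bddBelow_superlevel y)
    exact closure_minimal (fun t (ht : y < H t) => ht.le)
      (isClosed_le continuous_const h.continuous) hmem

lemma strictMono_genInv (h : IsMonotoneLift H) : StrictMono (genInv H) := by
  intro y y' hy
  by_contra! hle
  have := h.monotone hle
  rw [h.apply_genInv, h.apply_genInv] at this
  linarith

lemma genInv_add_one (h : IsMonotoneLift H) (y : ℝ) : genInv H (y + 1) = genInv H y + 1 := by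
  refine eq_of_forall_gt_iff fun t => ?_
  rw [← lt_sub_iff_add_lt, h.genInv_lt_iff, h.genInv_lt_iff]
  constructor
  · rintro ⟨s, hs, hst⟩
    refine ⟨s - 1, ?_, by linarith⟩
    have := h.add_one (s - 1)
    rw [sub_add_cancel] at this
    linarith
  · rintro ⟨s, hs, hst⟩
    exact ⟨s + 1, by rw [h.add_one]; linarith, by linarith⟩

lemma genInv_mem_Ioo (h : IsMonotoneLift H) {t a b : ℝ} (ht : t ∈ Ioo (H a) (H b)) :
    genInv H t ∈ Ioo a b := by
  constructor
  · by_contra! hle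
    have := h.monotone hle
    rw [h.apply_genInv] at this
    exact absurd ht.1 (not_lt.mpr this)
  · by_contra! hle
    have := h.monotone hle
    rw [h.apply_genInv] at this
    exact absurd ht.2 (not_lt.mpr this)

lemma genInv_preimage_Ioo_ae_eq (h : IsMonotoneLift H) (a b : ℝ) :
    genInv H ⁻¹' Ioo a b =ᵐ[volume] Ioo (H a) (H b) := by
  have hsub : genInv H ⁻¹' Ioo a b ⊆ Icc (H a) (H b) := fun t ht => by
    have h1 := h.monotone ht.1.le
    have h2 := h.monotone ht.2.le
    rw [h.apply_genInv] at h1 h2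
    exact ⟨h1, h2⟩
  refine Filter.EventuallyLE.antisymm ?_ ?_
  · exact (LE.le.eventuallyLE hsub).trans Ioo_ae_eq_Icc.symm.le
  · exact LE.le.eventuallyLE fun t ht => h.genInv_mem_Ioo ht

lemma volume_genInv_preimage_Ioc (h : IsMonotoneLift H) (a b : ℝ) :
    volume (genInv H ⁻¹' Ioc a b) = ENNReal.ofReal (H b - H a) := by
  apply le_antisymm
  · rw [← Real.volume_Icc]
    refine measure_mono fun t ht => ?_
    have h1 := h.monotone ht.1.le
    have h2 := h.monotone ht.2
    rw [h.apply_genInv] at h1 h2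
    exact ⟨h1, h2⟩
  · rw [← Real.volume_Ioo]
    exact measure_mono fun t ht => Ioo_subset_Ioc_self (h.genInv_mem_Ioo ht)

/-- At a continuity point `y` of the inverse the fibre `H ⁻¹' {y}` is a singleton. -/
lemma eq_genInv_of_continuousAt (h : IsMonotoneLift H) {x y : ℝ}
    (hc : ContinuousAt (genInv H) y) (hx : H x = y) : x = genInv H y := by
  apply le_antisymm
  · by_contra! hlt
    obtain ⟨z, hz, hz'⟩ := exists_between hlt
    have ht : Tendsto (genInv H) (𝓝[>] y) (𝓝 (genInv H y)) :=
      hc.tendsto.mono_left nhdsWithin_le_nhds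
    refine absurd (ge_of_tendsto ht ?_) (not_le.mpr hlt)
    filter_upwards [self_mem_nhdsWithin] with s hs
    by_contra! hlt'
    have := h.monotone hlt'.le
    rw [h.apply_genInv, hx] at this
    exact absurd hs (not_lt.mpr this)
  · have ht : Tendsto (genInv H) (𝓝[<] y) (𝓝 (genInv H y)) :=
      hc.tendsto.mono_left nhdsWithin_le_nhds
    refine le_of_tendsto ht ?_
    filter_upwards [self_mem_nhdsWithin] with s hs
    by_contra! hlt'
    have := h.monotone hlt'.le
    rw [h.apply_genInv, hx] at this
    exact absurd hs (not_lt.mpr this)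

/-- Together with its right-hand analogue this makes `H` constant across each jump of its inverse,
so values may later be interpolated inside a jump without changing their image under `H`. -/
lemma apply_leftLim_genInv (h : IsMonotoneLift H) (y : ℝ) :
    H (Function.leftLim (genInv H) y) = y := by
  have h1 := (h.continuous.continuousAt.tendsto).comp
    (h.strictMono_genInv.monotone.tendsto_leftLim y)
  have h2 : Tendsto (fun s : ℝ => s) (𝓝[<] y) (𝓝 y) := tendsto_id.mono_left nhdsWithin_le_nhds
  refine tendsto_nhds_unique h1 (h2.congr fun s => (h.apply_genInv s).symm)

lemma apply_rightLim_genInv (h : IsMonotoneLift H) (y : ℝ) :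
    H (Function.rightLim (genInv H) y) = y := by
  have h1 := (h.continuous.continuousAt.tendsto).comp
    (h.strictMono_genInv.monotone.tendsto_rightLim y)
  have h2 : Tendsto (fun s : ℝ => s) (𝓝[>] y) (𝓝 y) := tendsto_id.mono_left nhdsWithin_le_nhds
  refine tendsto_nhds_unique h1 (h2.congr fun s => (h.apply_genInv s).symm)

lemma leftLim_genInv_add_one (h : IsMonotoneLift H) (y : ℝ) :
    Function.leftLim (genInv H) (y + 1) = Function.leftLim (genInv H) y + 1 := by
  apply leftLim_eq_of_tendsto
  have h1 : Tendsto (fun s : ℝ => s - 1) (𝓝[<] (y + 1)) (𝓝[<] y) := by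
    refine tendsto_nhdsWithin_iff.mpr ⟨?_, ?_⟩
    · have : Tendsto (fun s : ℝ => s - 1) (𝓝 (y + 1)) (𝓝 (y + 1 - 1)) :=
        (continuous_sub_right 1).continuousAt
      rw [add_sub_cancel_right] at this
      exact this.mono_left nhdsWithin_le_nhds
    · filter_upwards [self_mem_nhdsWithin] with s hs
      simp only [mem_Iio] at hs ⊢
      linarith
  refine (((h.strictMono_genInv.monotone.tendsto_leftLim y).comp h1).add_const 1).congr fun s => ?_
  rw [Function.comp_apply, ← h.genInv_add_one, sub_add_cancel]

lemma rightLim_genInv_add_one (h : IsMonotoneLift H) (y : ℝ) :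
    Function.rightLim (genInv H) (y + 1) = Function.rightLim (genInv H) y + 1 := by
  apply rightLim_eq_of_tendsto
  have h1 : Tendsto (fun s : ℝ => s - 1) (𝓝[>] (y + 1)) (𝓝[>] y) := by
    refine tendsto_nhdsWithin_iff.mpr ⟨?_, ?_⟩
    · have : Tendsto (fun s : ℝ => s - 1) (𝓝 (y + 1)) (𝓝 (y + 1 - 1)) :=
        (continuous_sub_right 1).continuousAt
      rw [add_sub_cancel_right] at this
      exact this.mono_left nhdsWithin_le_nhds
    · filter_upwards [self_mem_nhdsWithin] with s hs
      simp only [mem_Ioi] at hs ⊢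
      linarith
  refine (((h.strictMono_genInv.monotone.tendsto_rightLim y).comp h1).add_const 1).congr
    fun s => ?_
  rw [Function.comp_apply, ← h.genInv_add_one, sub_add_cancel]

end IsMonotoneLift

lemma genInv_add_const (H : ℝ → ℝ) (α y : ℝ) :
    genInv (fun s => H s + α) y = genInv H (y - α) := by
  simp only [genInv, sub_lt_iff_lt_add]

/-! ### Distribution functions of densities on the circle -/

namespace IsProbDensity

variable {f : UnitAddCircle → ℝ}

lemma intervalIntegrable (hf : IsProbDensity f) (a b : ℝ) :
    IntervalIntegrable (fun t : ℝ => f t) volume a b := by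
  have hper : Function.Periodic (fun t : ℝ => f t) 1 := fun t => by
    simp only [AddCircle.coe_add_period]
  refine hper.intervalIntegrable one_ne_zero (t := 0) ?_ a b
  rw [intervalIntegrable_iff_integrableOn_Ioc_of_le (by norm_num)]
  exact (UnitAddCircle.measurePreserving_mk 0).integrable_comp_of_integrable hf.integrable

lemma ae_nonneg_coe (hf : IsProbDensity f) : ∀ᵐ t : ℝ, 0 ≤ f t := by
  have h : ∀ n : ℤ, ∀ᵐ t : ℝ, t ∈ Ioc (n : ℝ) (n + 1) → 0 ≤ f t := fun n => by
    rw [← ae_restrict_iff' measurableSet_Ioc]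
    exact (UnitAddCircle.measurePreserving_mk n).quasiMeasurePreserving.ae hf.nonneg
  rw [← ae_all_iff] at h
  filter_upwards [h] with t ht
  refine ht (⌈t⌉ - 1) ?_
  push_cast
  exact ⟨by linarith [Int.ceil_lt_add_one t], by linarith [Int.le_ceil t]⟩

lemma cdf_sub (hf : IsProbDensity f) (a b : ℝ) : cdf f b - cdf f a = ∫ t in a..b, f t :=
  intervalIntegral.integral_interval_sub_left (hf.intervalIntegrable _ _)
    (hf.intervalIntegrable _ _)

lemma cdf_zero (f : UnitAddCircle → ℝ) : cdf f 0 = 0 := intervalIntegral.integral_same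

lemma isMonotoneLift_cdf (hf : IsProbDensity f) : IsMonotoneLift (cdf f) where
  continuous := intervalIntegral.continuous_primitive (fun a b => hf.intervalIntegrable a b) 0
  monotone a b hab := by
    rw [← sub_nonneg, hf.cdf_sub]
    exact intervalIntegral.integral_nonneg_of_ae hab hf.ae_nonneg_coe
  add_one t := by
    rw [← sub_eq_iff_eq_add', hf.cdf_sub, UnitAddCircle.intervalIntegral_preimage t f,
      hf.integral_eq_one]

lemma cdf_one (hf : IsProbDensity f) : cdf f 1 = 1 := by
  have := hf.isMonotoneLift_cdf.add_one 0
  rwa [zero_add, cdf_zero, zero_add] at this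

lemma measurable_genInv_cdf (hf : IsProbDensity f) : Measurable (genInv (cdf f)) :=
  hf.isMonotoneLift_cdf.strictMono_genInv.monotone.measurable

lemma map_genInv_cdf (hf : IsProbDensity f) :
    Measure.map (genInv (cdf f)) volume
      = (volume : Measure ℝ).withDensity fun t => ENNReal.ofReal (f t) := by
  symm
  have hint : ∀ a b : ℝ, a ≤ b →
      (volume : Measure ℝ).withDensity (fun t => ENNReal.ofReal (f t)) (Ioc a b)
        = ENNReal.ofReal (cdf f b - cdf f a) := fun a b hab => by
    rw [withDensity_apply _ measurableSet_Ioc, hf.cdf_sub, intervalIntegral.integral_of_le hab,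
      ofReal_integral_eq_lintegral_ofReal]
    · exact (hf.intervalIntegrable a b).1
    · exact ae_restrict_of_ae hf.ae_nonneg_coe
  have : IsLocallyFiniteMeasure
      ((volume : Measure ℝ).withDensity fun t => ENNReal.ofReal (f t)) := by
    refine ⟨fun x => ⟨Ioc (x - 1) (x + 1), Ioc_mem_nhds (by linarith) (by linarith), ?_⟩⟩
    rw [hint _ _ (by linarith)]
    exact ENNReal.ofReal_lt_top
  refine Measure.ext_of_Ioc _ _ fun a b hab => ?_
  rw [hint a b hab.le, Measure.map_apply hf.measurable_genInv_cdf measurableSet_Ioc,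
    hf.isMonotoneLift_cdf.volume_genInv_preimage_Ioc]

/-- The quantile function, reduced modulo one, pushes Lebesgue measure on the unit interval
forward to the measure with the given density. -/
lemma measurePreserving_genInv_cdf (hf : IsProbDensity f) :
    MeasurePreserving (fun t : ℝ => (genInv (cdf f) t : UnitAddCircle))
      (volume.restrict (Ioo (0 : ℝ) 1)) (densityMeasure f) := by
  have hmk : Measurable ((↑) : ℝ → UnitAddCircle) := AddCircle.measurable_mk'
  refine ⟨hmk.comp hf.measurable_genInv_cdf, ?_⟩
  -- As `F 0 = 0` and `F 1 = 1`, restricting `t` to `(0, 1)` restricts the quantile to one period,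
  -- up to a null set.
  have hset := hf.isMonotoneLift_cdf.genInv_preimage_Ioo_ae_eq 0 1
  rw [cdf_zero, hf.cdf_one] at hset
  have h1 : Measure.map (genInv (cdf f)) (volume.restrict (Ioo (0 : ℝ) 1))
      = (volume.restrict (Ioc (0 : ℝ) (0 + 1))).withDensity fun t => ENNReal.ofReal (f t) := by
    rw [← Measure.restrict_congr_set hset,
      ← Measure.restrict_map hf.measurable_genInv_cdf measurableSet_Ioo, hf.map_genInv_cdf,
      restrict_withDensity measurableSet_Ioo, zero_add, Measure.restrict_congr_set Ioo_ae_eq_Ioc]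
  rw [show (fun t : ℝ => (genInv (cdf f) t : UnitAddCircle)) = (↑) ∘ genInv (cdf f) from rfl,
    ← Measure.map_map hmk hf.measurable_genInv_cdf, h1]
  ext s hs
  have hmp := UnitAddCircle.measurePreserving_mk 0
  rw [Measure.map_apply hmk hs, densityMeasure, withDensity_apply _ hs,
    withDensity_apply _ (hmk hs)]
  have hr := (hmp.restrict_preimage hs).map_eq
  conv_rhs => rw [← hr]
  rw [lintegral_map' _ hmk.aemeasurable]
  rw [hr]
  exact hf.integrable.aestronglyMeasurable.aemeasurable.ennreal_ofReal.restrict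

/-- The shifted quantile functions have the same law modulo one. -/
lemma measurePreserving_genInv_cdf_sub (hf : IsProbDensity f) (β : ℝ) :
    MeasurePreserving (fun t : ℝ => (genInv (cdf f) (t - β) : UnitAddCircle))
      (volume.restrict (Ioo (0 : ℝ) 1)) (densityMeasure f) := by
  -- The quantile commutes with adding one, so it descends to a circle map `V`; the shift by `β` is
  -- then a rotation of its argument, which preserves volume.
  have hper : Function.Periodic (fun t : ℝ => (genInv (cdf f) t : UnitAddCircle)) 1 := fun t => by
    simp only [hf.isMonotoneLift_cdf.genInv_add_one, AddCircle.coe_add_period]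
  let V : UnitAddCircle → UnitAddCircle := hper.lift
  have hV : ∀ t : ℝ, V t = (genInv (cdf f) t : UnitAddCircle) := fun t => hper.lift_coe t
  have hmk : MeasurePreserving ((↑) : ℝ → UnitAddCircle) (volume.restrict (Ioo (0 : ℝ) 1))
      volume := by
    have := UnitAddCircle.measurePreserving_mk 0
    rwa [zero_add, ← Measure.restrict_congr_set Ioo_ae_eq_Ioc] at this
  have hVm : Measurable V := by
    intro s hs
    have h1 : (V ⁻¹' s) = (fun x : UnitAddCircle => ((AddCircle.measurableEquivIco 1 0 x : ℝ)))
        ⁻¹' ((fun t : ℝ => (genInv (cdf f) t : UnitAddCircle)) ⁻¹' s) := by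
      ext x
      simp only [mem_preimage]
      rw [← hV]
      have : ((AddCircle.measurableEquivIco 1 0 x : ℝ) : UnitAddCircle) = x :=
        AddCircle.coe_equivIco
      rw [this]
    rw [h1]
    exact (measurable_subtype_coe.comp (AddCircle.measurableEquivIco 1 0).measurable)
      (hf.measurePreserving_genInv_cdf.measurable hs)
  have hVmp : MeasurePreserving V volume (densityMeasure f) := by
    refine ⟨hVm, ?_⟩
    rw [← hmk.map_eq, Measure.map_map hVm hmk.measurable, ← hf.measurePreserving_genInv_cdf.map_eq]
    rfl
  have hsub : MeasurePreserving (fun x : UnitAddCircle => x - (β : UnitAddCircle)) volume volume :=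
    measurePreserving_sub_right _ _
  exact (hVmp.comp hsub).comp hmk

end IsProbDensity

/-! ### Balanced monotone selections -/

/-- A monotone `T : ℝ → ℝ` with `T (x + 1) = T x + 1` and no mean displacement. -/
structure IsBalancedLift (T : ℝ → ℝ) : Prop where
  monotone : Monotone T
  add_one : ∀ x, T (x + 1) = T x + 1
  integral_eq : ∫ x in (0 : ℝ)..1, T x = 1 / 2

namespace IsMonotoneLift

variable {F G : ℝ → ℝ}

/-- Convergence of the mean of `x ↦ G⁻¹ (F x - β)` along a one-sided approach of `β` to `a`. -/
lemma tendsto_integral_genInv (hF : IsMonotoneLift F) (hG : IsMonotoneLift G) {a : ℝ}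
    {s : Set ℝ} {w : ℝ → ℝ}
    (hw : ∀ y, Tendsto (fun β => genInv G (y - β)) (𝓝[s] a) (𝓝 (w (y - a)))) :
    Tendsto (fun β => ∫ x in (0 : ℝ)..1, genInv G (F x - β)) (𝓝[s] a)
      (𝓝 (∫ x in (0 : ℝ)..1, w (F x - a))) := by
  have hv := hG.strictMono_genInv.monotone
  refine intervalIntegral.tendsto_integral_filter_of_dominated_convergence
    (fun _ => max |genInv G (F 0 - (a + 1))| |genInv G (F 1 - (a - 1))|) ?_ ?_ ?_ ?_
  · refine Eventually.of_forall fun β => ?_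
    have : Measurable fun x => genInv G (F x - β) :=
      hv.measurable.comp (hF.continuous.measurable.sub_const β)
    exact this.aestronglyMeasurable
  · have hnear : ∀ᶠ β in 𝓝[s] a, β ∈ Icc (a - 1) (a + 1) :=
      mem_nhdsWithin_of_mem_nhds (Icc_mem_nhds (by linarith) (by linarith))
    filter_upwards [hnear] with β hβ
    refine Eventually.of_forall fun x hx => ?_
    rw [uIoc_of_le zero_le_one] at hx
    rw [Real.norm_eq_abs]
    refine abs_le_max_abs_abs (hv ?_) (hv ?_)
    · linarith [hF.monotone hx.1.le, hβ.2]
    · linarith [hF.monotone hx.2, hβ.1]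
  · exact intervalIntegrable_const
  · exact Eventually.of_forall fun x _ => hw (F x)

/-- Some shift of the relation `G y + α = F x` contains the graph of a balanced lift. -/
lemma exists_balanced_selection (hF : IsMonotoneLift F) (hG : IsMonotoneLift G) :
    ∃ (α : ℝ) (T : ℝ → ℝ), IsBalancedLift T ∧ ∀ x, G (T x) = F x - α := by
  set v := genInv G with hv_def
  have hv : Monotone v := hG.strictMono_genInv.monotone
  have hvF : ∀ β, Monotone fun x => v (F x - β) := fun β x y hxy =>
    hv (sub_le_sub_right (hF.monotone hxy) β)
  set S : ℝ → ℝ := fun β => ∫ x in (0 : ℝ)..1, v (F x - β) with hS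
  have hanti : Antitone S := fun β γ hβγ =>
    intervalIntegral.integral_mono_on zero_le_one (hvF γ).intervalIntegrable
      (hvF β).intervalIntegrable fun x _ => hv (sub_le_sub_left hβγ (F x))
  -- At this shift the argument of `v` is at least `G 2 = G 1 + 1`, so the integrand is at least
  -- `1`; the shift in `hbd` similarly makes it at most `0`.
  have hne : 1 / 2 ≤ S (F 0 - G 2) := by
    have h1 : (1 : ℝ) ≤ v (G 2) := by
      by_contra! hlt
      have := hG.monotone hlt.le
      rw [hG.apply_genInv] at this
      have h2 := hG.add_one 1
      norm_num at h2
      linarith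
    have h2 : ∫ _ in (0 : ℝ)..1, (1 : ℝ) ≤ S (F 0 - G 2) :=
      intervalIntegral.integral_mono_on zero_le_one intervalIntegrable_const
        (hvF _).intervalIntegrable fun x hx =>
          h1.trans (hv (by linarith [hF.monotone hx.1]))
    norm_num at h2 ⊢
    linarith
  have hbd : S (F 1 - G (-1)) < 1 / 2 := by
    have h1 : v (G (-1)) ≤ 0 := by
      by_contra! hlt
      have := hG.monotone hlt.le
      rw [hG.apply_genInv] at this
      have h2 := hG.add_one (-1)
      norm_num at h2
      linarith
    have h2 : S (F 1 - G (-1)) ≤ ∫ _ in (0 : ℝ)..1, (0 : ℝ) :=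
      intervalIntegral.integral_mono_on zero_le_one (hvF _).intervalIntegrable
        intervalIntegrable_const fun x hx =>
          le_trans (hv (by linarith [hF.monotone hx.2])) h1
    norm_num at h2 ⊢
    linarith
  set A : Set ℝ := {β | 1 / 2 ≤ S β} with hA
  have hAne : A.Nonempty := ⟨_, hne⟩
  have hAbd : BddAbove A := ⟨F 1 - G (-1), fun β hβ => by
    by_contra! hlt
    exact absurd (le_trans hβ (hanti hlt.le)) (not_le.mpr hbd)⟩
  -- The mean `S` crosses `1 / 2` at `a`, possibly by a jump. As `β` increases to `a`, `y - β`
  -- decreases to `y - a`, so the left limit of `S` involves `rightLim v`, and vice versa.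
  set a := sSup A with ha
  have hsub : ∀ y : ℝ, Tendsto (fun β : ℝ => y - β) (𝓝 a) (𝓝 (y - a)) := fun y =>
    (continuous_const.sub continuous_id).continuousAt
  have hR : 1 / 2 ≤ ∫ x in (0 : ℝ)..1, Function.rightLim v (F x - a) := by
    have ht : Tendsto S (𝓝[<] a) (𝓝 (∫ x in (0 : ℝ)..1, Function.rightLim v (F x - a))) := by
      refine hF.tendsto_integral_genInv hG fun y => (hv.tendsto_rightLim (y - a)).comp ?_
      refine tendsto_nhdsWithin_iff.mpr ⟨(hsub y).mono_left nhdsWithin_le_nhds, ?_⟩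
      filter_upwards [self_mem_nhdsWithin] with β hβ
      exact sub_lt_sub_left hβ y
    refine ge_of_tendsto ht ?_
    filter_upwards [self_mem_nhdsWithin] with β hβ
    obtain ⟨γ, hγ, hβγ⟩ := exists_lt_of_lt_csSup hAne hβ
    exact le_trans hγ (hanti hβγ.le)
  have hL : ∫ x in (0 : ℝ)..1, Function.leftLim v (F x - a) ≤ 1 / 2 := by
    have ht : Tendsto S (𝓝[>] a) (𝓝 (∫ x in (0 : ℝ)..1, Function.leftLim v (F x - a))) := by
      refine hF.tendsto_integral_genInv hG fun y => (hv.tendsto_leftLim (y - a)).comp ?_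
      refine tendsto_nhdsWithin_iff.mpr ⟨(hsub y).mono_left nhdsWithin_le_nhds, ?_⟩
      filter_upwards [self_mem_nhdsWithin] with β hβ
      exact sub_lt_sub_left hβ y
    refine le_of_tendsto ht ?_
    filter_upwards [self_mem_nhdsWithin] with β hβ
    by_contra! hlt
    exact absurd (le_csSup hAbd (show β ∈ A from hlt.le)) (not_le.mpr hβ)
  have hmem : (1 / 2 : ℝ) ∈ segment ℝ (∫ x in (0 : ℝ)..1, Function.leftLim v (F x - a))
      (∫ x in (0 : ℝ)..1, Function.rightLim v (F x - a)) := by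
    rw [segment_eq_Icc (hL.trans hR)]
    exact ⟨hL, hR⟩
  -- The weights that average the two one-sided means to `1 / 2` also define `T`, pointwise.
  obtain ⟨p, q, hp, hq, hpq, hint⟩ := hmem
  have hLm : Monotone fun x => Function.leftLim v (F x - a) := fun x y hxy =>
    hv.leftLim (sub_le_sub_right (hF.monotone hxy) a)
  have hRm : Monotone fun x => Function.rightLim v (F x - a) := fun x y hxy =>
    hv.rightLim (sub_le_sub_right (hF.monotone hxy) a)
  refine ⟨a, fun x => p * Function.leftLim v (F x - a) + q * Function.rightLim v (F x - a),
    ⟨(hLm.const_mul hp).add (hRm.const_mul hq), fun x => ?_, ?_⟩, fun x => ?_⟩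
  · rw [hF.add_one, add_sub_right_comm, hG.leftLim_genInv_add_one, hG.rightLim_genInv_add_one]
    linear_combination hpq
  · rw [intervalIntegral.integral_add (hLm.intervalIntegrable.const_mul p)
      (hRm.intervalIntegrable.const_mul q), intervalIntegral.integral_const_mul,
      intervalIntegral.integral_const_mul]
    simpa only [smul_eq_mul] using hint
  · have hLR : Function.leftLim v (F x - a) ≤ Function.rightLim v (F x - a) :=
      (hv.leftLim_le le_rfl).trans (hv.le_rightLim le_rfl)
    obtain rfl : q = 1 - p := by linarith
    apply le_antisymm
    · rw [← hG.apply_rightLim_genInv (F x - a)]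
      exact hG.monotone (by simp only [← hv_def]; nlinarith)
    · rw [← hG.apply_leftLim_genInv (F x - a)]
      exact hG.monotone (by simp only [← hv_def]; nlinarith)

end IsMonotoneLift

/-! ### The dual potentials -/

lemma dist_coe_le (x y : ℝ) : dist (x : UnitAddCircle) y ≤ |x - y| := by
  rw [dist_eq_norm, ← AddCircle.coe_sub, UnitAddCircle.norm_eq]
  simpa using round_le (x - y) 0

/-- Subtracting the integer nearest to `s - y` from a lift `s` gives the lift closest to `y`. -/
lemma exists_coe_eq_dist_eq (a : UnitAddCircle) (y : ℝ) :
    ∃ x : ℝ, (x : UnitAddCircle) = a ∧ dist a (y : UnitAddCircle) = |x - y| := by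
  obtain ⟨s, rfl⟩ := QuotientAddGroup.mk_surjective a
  have hs : ((s - round (s - y) : ℝ) : UnitAddCircle) = s := by
    rw [AddCircle.coe_sub, sub_eq_self]
    exact (AddCircle.coe_eq_zero_iff 1).mpr ⟨round (s - y), by simp⟩
  refine ⟨s - round (s - y), hs, ?_⟩
  rw [dist_eq_norm, ← QuotientAddGroup.mk_sub]
  refine UnitAddCircle.norm_eq.trans ?_
  rw [sub_right_comm]

namespace IsBalancedLift

variable {T : ℝ → ℝ}

lemma intervalIntegrable_sub (hT : IsBalancedLift T) (a b : ℝ) :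
    IntervalIntegrable (fun s => T s - s) volume a b :=
  hT.monotone.intervalIntegrable.sub (continuous_id.intervalIntegrable a b)

lemma integral_sub_id (hT : IsBalancedLift T) (a b : ℝ) :
    ∫ s in a..b, (T s - s) = (∫ s in a..b, T s) - (b ^ 2 - a ^ 2) / 2 := by
  rw [intervalIntegral.integral_sub hT.monotone.intervalIntegrable
    intervalIntegral.intervalIntegrable_id, integral_id]

lemma periodic_primitive (hT : IsBalancedLift T) :
    Function.Periodic (fun x => -2 * ∫ s in (0 : ℝ)..x, (T s - s)) 1 := by
  intro x
  have hper : Function.Periodic (fun s => T s - s) 1 := fun s => by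
    simp only [hT.add_one]; ring
  have h0 : ∫ s in (0 : ℝ)..1, (T s - s) = 0 := by
    rw [hT.integral_sub_id, hT.integral_eq]; norm_num
  have h1 := hper.intervalIntegral_add_eq x 0
  rw [zero_add, h0] at h1
  have h2 := intervalIntegral.integral_add_adjacent_intervals
    (hT.intervalIntegrable_sub 0 x) (hT.intervalIntegrable_sub x (x + 1))
  dsimp only
  rw [← h2, h1, add_zero]

/-- The subgradient inequality for the primitive of `T`, which is convex because `T` is monotone. -/
lemma mul_sub_le_integral (hT : IsBalancedLift T) (x z : ℝ) :
    T x * (z - x) ≤ ∫ s in x..z, T s := by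
  have hconst : ∀ a b : ℝ, ∫ _ in a..b, T x = T x * (b - a) := fun a b => by
    rw [intervalIntegral.integral_const, smul_eq_mul, mul_comm]
  rcases le_total x z with h | h
  · rw [← hconst]
    exact intervalIntegral.integral_mono_on h intervalIntegrable_const
      hT.monotone.intervalIntegrable fun s hs => hT.monotone hs.1
  · have : ∫ s in z..x, T s ≤ ∫ _ in z..x, T x :=
      intervalIntegral.integral_mono_on h hT.monotone.intervalIntegrable
        intervalIntegrable_const fun s hs => hT.monotone hs.2
    rw [hconst] at this
    rw [intervalIntegral.integral_symm]
    linarith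

/-- A supporting slope of the primitive of `T` at a continuity point is the value of `T`. -/
lemma eq_of_forall_mul_sub_le (hT : IsBalancedLift T) {x y : ℝ} (hc : ContinuousAt T x)
    (h : ∀ z, y * (z - x) ≤ ∫ s in x..z, T s) : y = T x := by
  have hd : HasDerivAt (fun z => (∫ s in x..z, T s) - y * (z - x)) (T x - y * 1) x :=
    (intervalIntegral.integral_hasDerivAt_right hT.monotone.intervalIntegrable
      hT.monotone.measurable.stronglyMeasurable.stronglyMeasurableAtFilter hc).sub
      (((hasDerivAt_id x).sub_const x).const_mul y)
  have hmin : IsLocalMin (fun z => (∫ s in x..z, T s) - y * (z - x)) x := by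
    refine Eventually.of_forall fun z => ?_
    simp only [intervalIntegral.integral_same, sub_self, mul_zero]
    exact sub_nonneg.mpr (h z)
  linarith [hmin.hasDerivAt_eq_zero hd]

/-- Kantorovich potentials on the circle for the squared distance, tight exactly along `T`. -/
lemma exists_dual_potentials (hT : IsBalancedLift T) :
    ∃ Φ Ψ : UnitAddCircle → ℝ, Measurable Φ ∧ Measurable Ψ ∧
      (∃ C, ∀ x, |Φ x| ≤ C) ∧ (∃ C, ∀ y, |Ψ y| ≤ C) ∧
      (∀ x y, Φ x + Ψ y ≤ dist x y ^ 2) ∧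
      (∀ x : ℝ, |x - T x| ^ 2 ≤ Φ x + Ψ (T x)) ∧
      ∀ x y : ℝ, ContinuousAt T x → |x - y| ^ 2 ≤ Φ x + Ψ y → y = T x := by
  set Φ : UnitAddCircle → ℝ := hT.periodic_primitive.lift with hΦ
  have hΦc : ∀ x : ℝ, Φ x = -2 * ∫ s in (0 : ℝ)..x, (T s - s) := fun x =>
    hT.periodic_primitive.lift_coe x
  have hcont : Continuous Φ := by
    refine continuous_coinduced_dom.mpr ?_
    exact continuous_const.mul
      (intervalIntegral.continuous_primitive (fun a b => hT.intervalIntegrable_sub a b) 0)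
  -- Up to a constant, `z ^ 2 - Φ z` is twice the convex primitive of `T`, so optimality in `Ψ`
  -- becomes a statement about its supporting lines.
  have hΦsub : ∀ x z : ℝ, Φ z - Φ x = z ^ 2 - x ^ 2 - 2 * ∫ s in x..z, T s := fun x z => by
    rw [hΦc, hΦc, ← mul_sub, intervalIntegral.integral_interval_sub_left
      (hT.intervalIntegrable_sub _ _) (hT.intervalIntegrable_sub _ _), hT.integral_sub_id]
    ring
  obtain ⟨M, hM⟩ := (isCompact_range hcont).isBounded.exists_norm_le
  have hM' : ∀ x, |Φ x| ≤ M := fun x => hM _ (mem_range_self x)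
  have hlow : ∀ y x, -M ≤ dist x y ^ 2 - Φ x := fun y x => by
    linarith [sq_nonneg (dist x y), (abs_le.mp (hM' x)).2]
  have hbdd : ∀ y, BddBelow (range fun x => dist x y ^ 2 - Φ x) := fun y =>
    ⟨-M, by rintro _ ⟨x, rfl⟩; exact hlow y x⟩
  set Ψ : UnitAddCircle → ℝ := fun y => ⨅ x, (dist x y ^ 2 - Φ x) with hΨ
  have hΨle : ∀ x y, Ψ y ≤ dist x y ^ 2 - Φ x := fun x y => ciInf_le (hbdd y) x
  refine ⟨Φ, Ψ, hcont.measurable, ?_, ⟨M, hM'⟩, ⟨M, fun y => abs_le.mpr ⟨?_, ?_⟩⟩, ?_, ?_, ?_⟩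
  · refine (upperSemicontinuous_ciInf hbdd fun x => Continuous.upperSemicontinuous ?_).measurable
    fun_prop
  · exact le_ciInf (hlow y)
  · have h1 := hΨle y y
    rw [dist_self] at h1
    linarith [(abs_le.mp (hM' y)).1]
  · intro x y
    linarith [hΨle x y]
  · intro x
    rw [← sub_le_iff_le_add']
    refine le_ciInf fun a => ?_
    -- Lifting the competitor nearest to `T x` turns the circle distance into a distance on the
    -- line.
    obtain ⟨z, rfl, hz⟩ := exists_coe_eq_dist_eq a (T x)
    rw [hz, sq_abs, sq_abs]
    linarith [hΦsub x z, hT.mul_sub_le_integral x z]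
  · intro x y hc hxy
    -- Tightness makes `x` minimise `(z - y) ^ 2 - Φ z` over the line, so `y` is a supporting slope
    -- at `x`.
    refine hT.eq_of_forall_mul_sub_le hc fun z => ?_
    have h1 := hΨle z y
    have h2 := pow_le_pow_left₀ dist_nonneg (dist_coe_le z y) 2
    rw [sq_abs] at hxy h2
    linarith [hΦsub x z]

end IsBalancedLift

/-! ### Weak duality -/

section Duality

variable {Ω M N : Type*} [MeasurableSpace Ω] [MeasurableSpace M] [MeasurableSpace N]
  {P : Measure Ω} [IsFiniteMeasure P] {μ : Measure M} {ν : Measure N}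
  {X : Ω → M} {Y : Ω → N} {Φ : M → ℝ} {Ψ : N → ℝ} {c : Ω → ℝ}

lemma integrable_comp_of_abs_le (hX : Measurable X) (hΦ : Measurable Φ)
    (hΦb : ∃ C, ∀ x, |Φ x| ≤ C) : Integrable (fun t => Φ (X t)) P := by
  obtain ⟨C, hC⟩ := hΦb
  exact Integrable.of_bound (hΦ.comp hX).aestronglyMeasurable C
    (Eventually.of_forall fun t => hC (X t))

lemma integral_comp_add_comp (hX : MeasurePreserving X P μ) (hY : MeasurePreserving Y P ν)
    (hΦ : Measurable Φ) (hΨ : Measurable Ψ)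
    (hΦb : ∃ C, ∀ x, |Φ x| ≤ C) (hΨb : ∃ C, ∀ y, |Ψ y| ≤ C) :
    ∫ t, (Φ (X t) + Ψ (Y t)) ∂P = (∫ x, Φ x ∂μ) + ∫ y, Ψ y ∂ν := by
  rw [integral_add (integrable_comp_of_abs_le hX.measurable hΦ hΦb)
    (integrable_comp_of_abs_le hY.measurable hΨ hΨb), ← hX.map_eq, ← hY.map_eq,
    integral_map hX.measurable.aemeasurable hΦ.aestronglyMeasurable,
    integral_map hY.measurable.aemeasurable hΨ.aestronglyMeasurable]

lemma ofReal_dual_le_lintegral (hX : MeasurePreserving X P μ) (hY : MeasurePreserving Y P ν)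
    (hΦ : Measurable Φ) (hΨ : Measurable Ψ)
    (hΦb : ∃ C, ∀ x, |Φ x| ≤ C) (hΨb : ∃ C, ∀ y, |Ψ y| ≤ C)
    (hc : Integrable c P) (hc0 : ∀ t, 0 ≤ c t) (hle : ∀ t, Φ (X t) + Ψ (Y t) ≤ c t) :
    ENNReal.ofReal ((∫ x, Φ x ∂μ) + ∫ y, Ψ y ∂ν) ≤ ∫⁻ t, ENNReal.ofReal (c t) ∂P := by
  rw [← ofReal_integral_eq_lintegral_ofReal hc (Eventually.of_forall hc0),
    ← integral_comp_add_comp hX hY hΦ hΨ hΦb hΨb]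
  exact ENNReal.ofReal_le_ofReal (integral_mono
    ((integrable_comp_of_abs_le hX.measurable hΦ hΦb).add
      (integrable_comp_of_abs_le hY.measurable hΨ hΨb)) hc hle)

/-- The equality case of weak duality: a pointwise inequality between functions with equal integrals
is an equality almost everywhere. `hE` keeps `ENNReal.ofReal` from truncating the dual value. -/
lemma ae_eq_of_lintegral_le_ofReal_dual (hX : MeasurePreserving X P μ)
    (hY : MeasurePreserving Y P ν) (hΦ : Measurable Φ) (hΨ : Measurable Ψ)
    (hΦb : ∃ C, ∀ x, |Φ x| ≤ C) (hΨb : ∃ C, ∀ y, |Ψ y| ≤ C)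
    (hc : Integrable c P) (hc0 : ∀ t, 0 ≤ c t) (hle : ∀ t, Φ (X t) + Ψ (Y t) ≤ c t)
    (hE : 0 ≤ (∫ x, Φ x ∂μ) + ∫ y, Ψ y ∂ν)
    (h : ∫⁻ t, ENNReal.ofReal (c t) ∂P ≤ ENNReal.ofReal ((∫ x, Φ x ∂μ) + ∫ y, Ψ y ∂ν)) :
    ∀ᵐ t ∂P, Φ (X t) + Ψ (Y t) = c t := by
  rw [← ofReal_integral_eq_lintegral_ofReal hc (Eventually.of_forall hc0),
    ENNReal.ofReal_le_ofReal_iff hE, ← integral_comp_add_comp hX hY hΦ hΨ hΦb hΨb] at h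
  have hint : Integrable (fun t => Φ (X t) + Ψ (Y t)) P :=
    (integrable_comp_of_abs_le hX.measurable hΦ hΦb).add
      (integrable_comp_of_abs_le hY.measurable hΨ hΨb)
  exact (integral_eq_iff_of_ae_le hint hc (Eventually.of_forall hle)).mp
    (le_antisymm (integral_mono hint hc hle) h)

end Duality

/-! ### Costs in terms of quantile functions -/

variable {f g : UnitAddCircle → ℝ}

lemma shiftCost_eq_lintegral (f g : UnitAddCircle → ℝ) (β : ℝ) :
    shiftCost f g β = ∫⁻ t in Ioo (0 : ℝ) 1,
      ENNReal.ofReal (|genInv (cdf f) t - genInv (cdf g) (t - β)| ^ 2) := by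
  simp only [shiftCost, genInv_add_const]

lemma transportCost_eq_lintegral (hf : IsProbDensity f) {S : UnitAddCircle → UnitAddCircle}
    (hS : Measurable S) :
    transportCost (densityMeasure f) S = ∫⁻ t in Ioo (0 : ℝ) 1,
      ENNReal.ofReal (dist (genInv (cdf f) t : UnitAddCircle) (S (genInv (cdf f) t)) ^ 2) := by
  have hm : Measurable fun x => edist x (S x) ^ 2 := (measurable_id.edist hS).pow_const 2
  rw [transportCost, ← hf.measurePreserving_genInv_cdf.lintegral_comp hm]
  simp only [edist_dist, ENNReal.ofReal_pow dist_nonneg]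

lemma integrable_quantile_cost (hf : IsProbDensity f) (hg : IsProbDensity g) (β : ℝ) :
    Integrable (fun t => |genInv (cdf f) t - genInv (cdf g) (t - β)| ^ 2)
      (volume.restrict (Ioo (0 : ℝ) 1)) := by
  have hu := hf.isMonotoneLift_cdf.strictMono_genInv.monotone
  have hv := hg.isMonotoneLift_cdf.strictMono_genInv.monotone
  have hm : Measurable fun t => |genInv (cdf f) t - genInv (cdf g) (t - β)| ^ 2 := by
    have : Measurable fun t => genInv (cdf g) (t - β) :=
      hv.measurable.comp (measurable_id.sub_const β)
    exact (continuous_abs.measurable.comp (hu.measurable.sub this)).pow_const 2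
  refine Integrable.of_bound hm.aestronglyMeasurable
    ((max |genInv (cdf f) 0| |genInv (cdf f) 1|
      + max |genInv (cdf g) (0 - β)| |genInv (cdf g) (1 - β)|) ^ 2) ?_
  filter_upwards [ae_restrict_mem measurableSet_Ioo] with t ht
  rw [Real.norm_of_nonneg (by positivity)]
  refine pow_le_pow_left₀ (abs_nonneg _) ((abs_sub _ _).trans (add_le_add ?_ ?_)) 2
  · exact abs_le_max_abs_abs (hu ht.1.le) (hu ht.2.le)
  · exact abs_le_max_abs_abs (hv (sub_le_sub_right ht.1.le β)) (hv (sub_le_sub_right ht.2.le β))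

lemma integrable_dist_sq {S : ℝ → UnitAddCircle} {X : ℝ → UnitAddCircle} (hS : Measurable S)
    (hX : Measurable X) :
    Integrable (fun t => dist (X t) (S t) ^ 2) (volume.restrict (Ioo (0 : ℝ) 1)) := by
  refine Integrable.of_bound ((hX.dist hS).pow_const 2).aestronglyMeasurable 1
    (Eventually.of_forall fun t => ?_)
  rw [Real.norm_of_nonneg (by positivity), dist_eq_norm]
  have := AddCircle.norm_le_half_period (p := (1 : ℝ)) (x := X t - S t) one_ne_zero
  rw [abs_one] at this
  exact pow_le_one₀ (norm_nonneg _) (by linarith)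

/-! ### The shift map -/

/-- For `t` in `(0, 1)` the quantile is its own representative in `[0, 1)`, and `F` undoes it. -/
lemma shiftMap_genInv (hf : IsProbDensity f) (g : UnitAddCircle → ℝ) (α : ℝ) {t : ℝ}
    (ht : t ∈ Ioo (0 : ℝ) 1) :
    shiftMap f g α (genInv (cdf f) t) = (genInv (cdf g) (t - α) : UnitAddCircle) := by
  have hF := hf.isMonotoneLift_cdf
  have hu : genInv (cdf f) t ∈ Ioo (0 : ℝ) 1 := hF.genInv_mem_Ioo (by
    rwa [IsProbDensity.cdf_zero, hf.cdf_one])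
  have hrep : (AddCircle.equivIco 1 0 (genInv (cdf f) t : UnitAddCircle) : ℝ)
      = genInv (cdf f) t :=
    AddCircle.equivIco_coe_of_mem (by rw [zero_add]; exact Ioo_subset_Ico_self hu)
  rw [shiftMap, hrep, hF.apply_genInv, genInv_add_const]

lemma measurable_shiftMap (hf : IsProbDensity f) (hg : IsProbDensity g) (α : ℝ) :
    Measurable (shiftMap f g α) := by
  have h1 : Measurable fun x : UnitAddCircle => (AddCircle.measurableEquivIco 1 0 x : ℝ) :=
    measurable_subtype_coe.comp (AddCircle.measurableEquivIco 1 0).measurable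
  have h2 : Measurable fun y => genInv (fun s => cdf g s + α) y := by
    simp only [genInv_add_const]
    exact hg.measurable_genInv_cdf.comp (measurable_id.sub_const α)
  exact AddCircle.measurable_mk'.comp
    (h2.comp (hf.isMonotoneLift_cdf.continuous.measurable.comp h1))

lemma measurePreserving_shiftMap (hf : IsProbDensity f) (hg : IsProbDensity g) (α : ℝ) :
    MeasurePreserving (shiftMap f g α) (densityMeasure f) (densityMeasure g) := by
  refine ⟨measurable_shiftMap hf hg α, ?_⟩
  rw [← hf.measurePreserving_genInv_cdf.map_eq,
    ← (hg.measurePreserving_genInv_cdf_sub α).map_eq,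
    Measure.map_map (measurable_shiftMap hf hg α) hf.measurePreserving_genInv_cdf.measurable]
  refine Measure.map_congr ?_
  filter_upwards [ae_restrict_mem measurableSet_Ioo] with t ht
  exact shiftMap_genInv hf g α ht

lemma ae_eq_shiftMap (hf : IsProbDensity f) (hg : IsProbDensity g) {α : ℝ}
    {S : UnitAddCircle → UnitAddCircle} (hS : Measurable S)
    (h : ∀ᵐ t ∂volume.restrict (Ioo (0 : ℝ) 1),
      S (genInv (cdf f) t) = (genInv (cdf g) (t - α) : UnitAddCircle)) :
    S =ᵐ[densityMeasure f] shiftMap f g α := by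
  have hX := hf.measurePreserving_genInv_cdf
  rw [EventuallyEq, ← hX.map_eq, ae_map_iff hX.measurable.aemeasurable
    (measurableSet_eq_fun hS (measurable_shiftMap hf hg α))]
  filter_upwards [h, ae_restrict_mem measurableSet_Ioo] with t ht ht'
  rw [ht, shiftMap_genInv hf g α ht']

/-- There is a shift `α` whose map solves the transport problem and whose one-dimensional cost is
the minimal cost; both solutions are unique. -/
theorem exists_optimal_shift (hf : IsProbDensity f) (hg : IsProbDensity g) :
    ∃ (α : ℝ) (E : ℝ≥0∞), shiftCost f g α = E ∧
      transportCost (densityMeasure f) (shiftMap f g α) = E ∧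
      (∀ β, E ≤ shiftCost f g β) ∧ (∀ β, shiftCost f g β ≤ E → β = α) ∧
      (∀ S, MeasurePreserving S (densityMeasure f) (densityMeasure g) →
        E ≤ transportCost (densityMeasure f) S) ∧
      ∀ S, MeasurePreserving S (densityMeasure f) (densityMeasure g) →
        transportCost (densityMeasure f) S ≤ E → S =ᵐ[densityMeasure f] shiftMap f g α := by
  have hF := hf.isMonotoneLift_cdf
  have hG := hg.isMonotoneLift_cdf
  obtain ⟨α, T, hT, hGT⟩ := hF.exists_balanced_selection hG
  obtain ⟨Φ, Ψ, hΦ, hΨ, hΦb, hΨb, hle, htight, huniq⟩ := hT.exists_dual_potentials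
  set u := genInv (cdf f) with hu
  set v := genInv (cdf g) with hv
  have hX : MeasurePreserving (fun t : ℝ => (u t : UnitAddCircle))
    (volume.restrict (Ioo (0 : ℝ) 1)) (densityMeasure f) := hf.measurePreserving_genInv_cdf
  have hY : ∀ β, MeasurePreserving (fun t : ℝ => (v (t - β) : UnitAddCircle))
    (volume.restrict (Ioo (0 : ℝ) 1)) (densityMeasure g) := hg.measurePreserving_genInv_cdf_sub
  have hcontT : ∀ᵐ t ∂volume.restrict (Ioo (0 : ℝ) 1), ContinuousAt T (u t) := by
    -- A monotone `T` has countably many discontinuities, and `u` is injective, so only countably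
    -- many `t` are lost.
    have hcount := hT.monotone.countable_not_continuousAt.preimage hF.strictMono_genInv.injective
    filter_upwards [hcount.ae_notMem _] with t ht
    exact not_not.mp ht
  have hcontv : ∀ᵐ t ∂volume.restrict (Ioo (0 : ℝ) 1), ContinuousAt v (t - α) := by
    have hcount := hG.strictMono_genInv.monotone.countable_not_continuousAt.preimage
      (sub_left_injective (b := α))
    filter_upwards [hcount.ae_notMem _] with t ht
    exact not_not.mp ht
  have hTu : ∀ᵐ t ∂volume.restrict (Ioo (0 : ℝ) 1), T (u t) = v (t - α) := by
    filter_upwards [hcontv] with t ht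
    exact hG.eq_genInv_of_continuousAt ht (by rw [hGT, hF.apply_genInv])
  have hcle : ∀ x y : ℝ, Φ x + Ψ y ≤ |x - y| ^ 2 := fun x y =>
    (hle x y).trans (pow_le_pow_left₀ dist_nonneg (dist_coe_le x y) 2)
  have hcosteq : ∀ᵐ t ∂volume.restrict (Ioo (0 : ℝ) 1),
      |u t - v (t - α)| ^ 2 = Φ (u t) + Ψ (v (t - α)) := by
    filter_upwards [hTu] with t ht
    have := htight (u t)
    rw [ht] at this
    exact le_antisymm this (hcle _ _)
  set K : ℝ := (∫ x, Φ x ∂densityMeasure f) + ∫ y, Ψ y ∂densityMeasure g with hK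
  have hKint : ∫ t in Ioo (0 : ℝ) 1, |u t - v (t - α)| ^ 2 = K := by
    rw [integral_congr_ae hcosteq, integral_comp_add_comp hX (hY α) hΦ hΨ hΦb hΨb]
  have hK0 : 0 ≤ K := by
    rw [← hKint]
    exact integral_nonneg fun t => by positivity
  have hshift : shiftCost f g α = ENNReal.ofReal K := by
    rw [shiftCost_eq_lintegral, ← hKint, ofReal_integral_eq_lintegral_ofReal
      (integrable_quantile_cost hf hg α) (Eventually.of_forall fun t => by positivity)]
  refine ⟨α, ENNReal.ofReal K, hshift, ?_, ?_, ?_, ?_, ?_⟩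
  · rw [transportCost_eq_lintegral hf (measurable_shiftMap hf hg α), ← hshift,
      shiftCost_eq_lintegral]
    refine lintegral_congr_ae ?_
    filter_upwards [hcosteq, ae_restrict_mem measurableSet_Ioo] with t ht ht'
    rw [shiftMap_genInv hf g α ht']
    congr 1
    -- The circle cost lies between `Φ + Ψ` and the line cost, which agree here.
    exact le_antisymm (pow_le_pow_left₀ dist_nonneg (dist_coe_le _ _) 2) (ht.le.trans (hle _ _))
  · intro β
    rw [shiftCost_eq_lintegral]
    exact ofReal_dual_le_lintegral hX (hY β) hΦ hΨ hΦb hΨb (integrable_quantile_cost hf hg β)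
      (fun t => by positivity) fun t => hcle _ _
  · intro β hβ
    rw [shiftCost_eq_lintegral] at hβ
    have h := ae_eq_of_lintegral_le_ofReal_dual hX (hY β) hΦ hΨ hΦb hΨb
      (integrable_quantile_cost hf hg β) (fun t => by positivity) (fun t => hcle _ _) hK0 hβ
    have : NeZero (volume.restrict (Ioo (0 : ℝ) 1)) := ⟨by simp [Measure.restrict_eq_zero]⟩
    obtain ⟨t, ht, htc⟩ := (h.and hcontT).exists
    -- Tightness at a single such `t` gives `v (t - β) = T (u t)`; applying `G` yields `t - β = t -
    -- α`.
    have h1 := congrArg (cdf g) (huniq _ _ htc ht.ge)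
    rw [hG.apply_genInv, hGT, hF.apply_genInv] at h1
    linarith
  · intro S hS
    rw [transportCost_eq_lintegral hf hS.measurable]
    exact ofReal_dual_le_lintegral hX (hS.comp hX) hΦ hΨ hΦb hΨb
      (integrable_dist_sq (hS.comp hX).measurable hX.measurable)
      (fun t => by positivity) fun t => hle _ _
  · intro S hS hScost
    rw [transportCost_eq_lintegral hf hS.measurable] at hScost
    have h := ae_eq_of_lintegral_le_ofReal_dual hX (hS.comp hX) hΦ hΨ hΦb hΨb
      (integrable_dist_sq (hS.comp hX).measurable hX.measurable)
      (fun t => by positivity) (fun t => hle _ _) hK0 hScost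
    refine ae_eq_shiftMap hf hg hS.measurable ?_
    filter_upwards [h, hcontT, hTu] with t ht htc htT
    -- The lift of `S (u t)` nearest to `u t` realises the circle cost on the line, so tightness
    -- forces it to equal `T (u t)`.
    obtain ⟨y, hy, hdist⟩ := exists_coe_eq_dist_eq (S (u t)) (u t)
    rw [Function.comp_apply, dist_comm, hdist, abs_sub_comm, ← hy] at ht
    rw [← hy, huniq _ _ htc ht.ge, htT]

end CircleOT

theorem mainTheorem1 (f g : UnitAddCircle → ℝ)
    (hf : CircleOT.IsProbDensity f) (hg : CircleOT.IsProbDensity g) :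
    CircleOT.wasserstein2 (CircleOT.densityMeasure f) (CircleOT.densityMeasure g) ^ 2
        = (⨅ α : ℝ, CircleOT.shiftCost f g α) ∧
    (∃! αs : ℝ, ∀ β : ℝ, CircleOT.shiftCost f g αs ≤ CircleOT.shiftCost f g β) ∧
    ∀ αs : ℝ, (∀ β : ℝ, CircleOT.shiftCost f g αs ≤ CircleOT.shiftCost f g β) →
      CircleOT.IsOptimalMap (CircleOT.densityMeasure f) (CircleOT.densityMeasure g)
          (CircleOT.shiftMap f g αs) ∧
        ∀ S : UnitAddCircle → UnitAddCircle,
          CircleOT.IsOptimalMap (CircleOT.densityMeasure f) (CircleOT.densityMeasure g) S →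
            S =ᵐ[CircleOT.densityMeasure f] CircleOT.shiftMap f g αs := by
  obtain ⟨α, E, hα, hTE, hshift, hshift', htrans, htrans'⟩ := CircleOT.exists_optimal_shift hf hg
  have hmp := CircleOT.measurePreserving_shiftMap hf hg α
  have huniq : ∀ αs : ℝ, (∀ β : ℝ, CircleOT.shiftCost f g αs ≤ CircleOT.shiftCost f g β) →
      αs = α := fun αs h => hshift' αs (hα ▸ h α)
  refine ⟨?_, ⟨α, fun β => hα ▸ hshift β, huniq⟩, fun αs h => ?_⟩
  · rw [CircleOT.wasserstein2, ← ENNReal.rpow_natCast, ← ENNReal.rpow_mul]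
    norm_num
    apply le_antisymm
    · exact iInf₂_le_of_le _ hmp (hTE.le.trans (le_iInf hshift))
    · exact iInf_le_of_le α (hα.le.trans (le_iInf₂ htrans))
  · obtain rfl := huniq αs h
    exact ⟨⟨hmp, fun S hS => hTE.le.trans (htrans S hS)⟩, fun S hS =>
      htrans' S hS.1 ((hS.2 _ hmp).trans hTE.le)⟩
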